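/- **Setting.** Let $\mathcal N$ be a finite set of agents and $\mathcal A$ a finite set of alternatives. A *preference* (type) is a total preorder $\succcurlyeq$ on $\mathcal A\times\mathbb R$ (alternative, payment). A function $u:\mathcal A\times\mathbb R\to\mathbb R$ *represents* $\succcurlyeq$ if $(a,z_a)\succcurlyeq(b,z_b)\iff u(a,z_a)\ge u(b,z_b)$ for all $a,b,z_a,z_b$; it is *quasi-linear* if $u(a,z)=v(a)-z$ for some $v:\mathcal A\to\mathbb R$. Each agent $i$ has a set $T_i$ of types. A *mechanism* is a pair $x:\prod_i T_i\to\mathcal A$, $p:\prod_i T_i\to\mathbb R^{\mathcal N}$; it is *onto* if $x$ is onto, and *incentive-compatible* if for every profile $t$, every agent $i$ and every $s\in T_i$, the type $t_i$ weakly prefers $(x(t),p_i(t))$ to $(x(s,t_{-i}),p_i(s,t_{-i}))$. Agent $i$ *has no influence on the alternative* if $x(s,t_{-i})=x(t)$ for all $t$ and all $s\in T_i$. **Mechanism 2.** Let $\emptyset\ne\mathcal A'\subseteq\mathcal A$, let $w\in\Delta(\mathcal N)$ (that is, $w\in[0,1]^{\mathcal N}$ and $\sum_i w_i=1$) and $c\in\mathbb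 R^{\mathcal A}$. For each agent $i$ and each type in $T_i$ fix an arbitrary quasi-linear utility that represents this type, and for a profile $t$ let $u_i$ be the one fixed for $t_i$. The mechanism chooses $$x(t)=a^\star\in\operatorname*{argmax}_{a\in\mathcal A'}\Big(c_a+\sum_i w_i\,u_i(a,0)\Big),$$ ties being broken in any way for which the agents with $w_i=0$ have no influence on the alternative, and the payments are $$p_i(t)=h_i(t_{-i})-\frac1{w_i}\Big(c_{a^\star}+\sum_{j\ne i}w_j\,u_j(a^\star,0)\Big)\ \text{ if } w_i>0,\qquad p_i(t)=h_i(t_{-i})\ \text{ if } w_i=0,$$ for some functions $h_i$ of the reports of the other agents. **Theorem.** Suppose that every type of every agent is represented by a quasi-linear utility function. (a) For all $\mathcal A'$, $w$ and $c$ as above (and all choices of the representations, of the tie-breaking and of the $h_i$), Mechanism 2 is incentive-compatible. (b) Suppose that $|\mathcal A|\ge3$ and that, for every agent $i$, every quasi-linear utility function represents some type in $T_i$. Then for every onto incentive-compatible mechanism $(x,p)$ there are $w\in\Delta(\mathcal N)$ and $c\in\mathbb R^{\mathcal A}$ such that, for every choice of quasi-linear representations $u_i$ of the types: - $x(t)\in\operatorname{argmax}_{a\in\mathcal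 A}\big(c_a+\sum_i w_i\,u_i(a,0)\big)$ for every profile $t$; - for every agent $i$ with $w_i>0$ there is a function $h_i$ with $p_i(t)=h_i(t_{-i})-\frac1{w_i}\big(c_{x(t)}+\sum_{j\ne i}w_j\,u_j(x(t),0)\big)$ for every profile $t$; - for every agent $i$ with $w_i=0$ the payment depends only on the reports of the others and on the chosen alternative: $p_i(t)=h_i(t_{-i},x(t))$ for some function $h_i$. In particular, if the agents of weight zero have no influence on the alternative, then $(x,p)$ is Mechanism 2 with $\mathcal A'=\mathcal A$, $w$ and $c$. -/

import Mathlib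

open Finset

/-- A preference over `A × ℝ` (pairs of an alternative and a payment of the agent): a total
preorder, `t.rel o o'` meaning that `o` is weakly preferred to `o'`. Preferences are the types of
the agents. -/
structure Preference (A : Type*) where
  rel : A × ℝ → A × ℝ → Prop
  total : ∀ o o', rel o o' ∨ rel o' o
  trans : ∀ o o' o'', rel o o' → rel o' o'' → rel o o''

/-- The utility function `u` represents the preference `t`. -/
def Represents {A : Type*} (u : A × ℝ → ℝ) (t : Preference A) : Prop :=
  ∀ (a b : A) (za zb : ℝ), t.rel (a, za) (b, zb) ↔ u (a, za) ≥ u (b, zb)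

/-- `u` is quasi-linear: `u (a, z) = v a - z` for some valuation `v`. -/
def IsQuasiLinear {A : Type*} (u : A × ℝ → ℝ) : Prop :=
  ∃ v : A → ℝ, ∀ (a : A) (z : ℝ), u (a, z) = v a - z

section Mechanisms

variable {N A : Type*}

/-- Profiles of reported types, one type of the type set `D i` for each agent `i`. -/
abbrev Profile (D : N → Set (Preference A)) : Type _ := ∀ i, D i

/-- Profiles of reports of all the agents other than `i`. -/
abbrev OthersProfile (D : N → Set (Preference A)) (i : N) : Type _ :=
  ∀ j : {j : N // j ≠ i}, D j

/-- `t_{-i}`: the reports in `t` of the agents other than `i`. -/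
def others {D : N → Set (Preference A)} (t : Profile D) (i : N) : OthersProfile D i :=
  fun j => t j

/-- The (direct) mechanism with allocation rule `x` and payment rule `p` is incentive compatible:
an agent whose type is `t i` weakly prefers the outcome of reporting `t i` to the outcome of any
other report `s`, whatever the reports of the other agents are. -/
def IsIncentiveCompatible [DecidableEq N] {D : N → Set (Preference A)}
    (x : Profile D → A) (p : Profile D → N → ℝ) : Prop :=
  ∀ (t : Profile D) (i : N) (s : D i),
    (t i : Preference A).rel (x t, p t i)
      (x (Function.update t i s), p (Function.update t i s) i)

/-- Agent `i` has no influence on the chosen alternative. -/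
def HasNoInfluence [DecidableEq N] {D : N → Set (Preference A)}
    (x : Profile D → A) (i : N) : Prop :=
  ∀ (t : Profile D) (s : D i), x (Function.update t i s) = x t

/-- `u i` chooses, for every type of Agent `i`, a quasi-linear utility function which represents
it. -/
def IsQuasiLinearChoice (D : N → Set (Preference A)) (u : ∀ i, D i → A × ℝ → ℝ) : Prop :=
  ∀ (i : N) (s : D i), IsQuasiLinear (u i s) ∧ Represents (u i s) (s : Preference A)

variable [Fintype N]

/-- `x t` is in the argmax over `a ∈ A'` of `c a + ∑ i, w i * u i (a, 0)`, for every profile `t`. -/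
def IsAffineMaximizer {D : N → Set (Preference A)} (A' : Set A) (w : N → ℝ) (c : A → ℝ)
    (u : ∀ i, D i → A × ℝ → ℝ) (x : Profile D → A) : Prop :=
  ∀ t : Profile D, x t ∈ A' ∧
    ∀ a ∈ A', c a + ∑ i, w i * u i (t i) (a, 0) ≤ c (x t) + ∑ i, w i * u i (t i) (x t, 0)

/-- The payment of Agent `i`, of positive weight, is
`h (t_{-i}) - (1 / w i) * (c a + ∑ j ≠ i, w j * u j (a, 0))` for the chosen alternative `a`. -/
def HasVCGPayment [DecidableEq N] {D : N → Set (Preference A)} (w : N → ℝ) (c : A → ℝ)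
    (u : ∀ i, D i → A × ℝ → ℝ) (x : Profile D → A) (p : Profile D → N → ℝ) (i : N) : Prop :=
  ∃ h : OthersProfile D i → ℝ, ∀ t : Profile D,
    p t i = h (others t i) -
      1 / w i * (c (x t) + ∑ j ∈ univ.erase i, w j * u j (t j) (x t, 0))

/-- The mechanism `(x, p)` is the VCG mechanism on preferences which is defined by `A'`, `w` and
`c`, when the types are represented by the quasi-linear utility functions chosen by `u`. Ties in
the argmax are broken in any way that gives the agents of weight zero no influence on the chosen
alternative. -/
structure IsPreferenceVCG [DecidableEq N] {D : N → Set (Preference A)} (A' : Set A) (w : N → ℝ)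
    (c : A → ℝ) (u : ∀ i, D i → A × ℝ → ℝ) (x : Profile D → A) (p : Profile D → N → ℝ) :
    Prop where
  maximizes : IsAffineMaximizer A' w c u x
  noInfluence : ∀ i, w i = 0 → HasNoInfluence x i
  payment_of_pos : ∀ i, 0 < w i → HasVCGPayment w c u x p i
  payment_of_zero : ∀ i, w i = 0 →
    ∃ h : OthersProfile D i → ℝ, ∀ t : Profile D, p t i = h (others t i)

end Mechanisms

/-! For (a), truthful reporting gives an agent of positive weight the utility `1 / w i` times the
maximized objective, minus a term in the others' reports, so no misreport helps. An agent of weight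
zero cannot change the outcome at all.

For (b), every valuation determines a type, so the mechanism pulls back to valuations. There
incentive compatibility makes the allocation rule positively associated, and Roberts' theorem
(`PositiveAssociation.exists_affine_maximizer`) applies. It studies which vectors of advantages of
`x` over `y` are compatible with choosing `x`. These sets are open and upper, and add along `x, y,
z`. Their thresholds on the diagonal are differences `c y - c x`. With three alternatives their
translates all coincide in one convex cone, and a separating hyperplane supplies `w`.

Payments of agents of positive weight are then forced, since such an agent can make any alternative
the maximizer (`TruthfulOnValuations.payment_le`). For the others, a payment depending on more than
`t_{-i}` and the alternative would invite a misreport. -/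

section AffineMaximizers

variable {N A : Type*}

/-- Positive association of differences: the chosen alternative remains chosen when its advantage
over every other alternative increases strictly for every agent. -/
def PositiveAssociation (f : (N → A → ℝ) → A) : Prop :=
  ∀ v v' : N → A → ℝ,
    (∀ i, ∀ b, b ≠ f v → v i (f v) - v i b < v' i (f v) - v' i b) → f v' = f v

/-- The vectors that strictly exceed the vector of advantages of `x` over `y` at some profile of
valuations at which `x` is chosen. -/
def advantageSet (f : (N → A → ℝ) → A) (x y : A) : Set (N → ℝ) :=
  {α | ∃ v, f v = x ∧ ∀ i, v i x - v i y < α i}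

/-- The infimum of the uniform advantages in `advantageSet f x y`. -/
noncomputable def advantageGap (f : (N → A → ℝ) → A) (x y : A) : ℝ :=
  sInf {r | (fun _ => r) ∈ advantageSet f x y}

/-- The translate of `advantageSet f x y` for which the uniform advantages are the positive
reals. -/
def advantageCone (f : (N → A → ℝ) → A) (x y : A) : Set (N → ℝ) :=
  {α | (fun i => α i + advantageGap f x y) ∈ advantageSet f x y}

variable {f : (N → A → ℝ) → A} {x y z : A}

/-! ### Advantage sets of a positively associated rule -/

theorem PositiveAssociation.not_forall_lt (hf : PositiveAssociation f) {v u : N → A → ℝ}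
    (h : f v ≠ f u) : ¬ ∀ i, v i (f v) - v i (f u) < u i (f v) - u i (f u) := by
  classical
  intro hlt
  let m : N → ℝ := fun i => ((v i (f v) - v i (f u)) + (u i (f v) - u i (f u))) / 2
  -- The advantage of `f v` over `f u` is halfway between its values at `v` and `u`, and all else is
  -- so low that positive association forces both `f w = f v` and `f w = f u`.
  let w : N → A → ℝ := fun i z => if z = f v then m i else if z = f u then 0 else
    min (m i - v i (f v) + v i z) (u i z - u i (f u)) - 1
  have hwv : ∀ i, w i (f v) = m i := fun i => if_pos rfl
  have hwu : ∀ i, w i (f u) = 0 := fun i => by simp [w, h.symm]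
  have hm : ∀ i, m i = ((v i (f v) - v i (f u)) + (u i (f v) - u i (f u))) / 2 := fun i => rfl
  have h1 : f w = f v := by
    refine hf v w fun i b hb => ?_
    by_cases hbu : b = f u
    · rw [hbu, hwv, hwu, hm]; linarith [hlt i]
    · have : w i b = min (m i - v i (f v) + v i b) (u i b - u i (f u)) - 1 := by simp [w, hb, hbu]
      rw [hwv, this]
      linarith [min_le_left (m i - v i (f v) + v i b) (u i b - u i (f u))]
  have h2 : f w = f u := by
    refine hf u w fun i b hb => ?_
    by_cases hbv : b = f v
    · rw [hbv, hwv, hwu, hm]; linarith [hlt i]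
    · have : w i b = min (m i - v i (f v) + v i b) (u i b - u i (f u)) - 1 := by simp [w, hb, hbv]
      rw [hwu, this]
      linarith [min_le_right (m i - v i (f v) + v i b) (u i b - u i (f u))]
  exact h (h1.symm.trans h2)

/-- Values outside `S` can be pushed down until choosing there contradicts `not_forall_lt`;
comparisons on `S` can thus be prescribed freely. -/
theorem PositiveAssociation.exists_mem (hf : PositiveAssociation f)
    (hs : Function.Surjective f) {S : Set A} (hS : S.Nonempty) (g : N → A → ℝ) :
    ∃ w : N → A → ℝ, (∀ i, ∀ z ∈ S, w i z = g i z) ∧ f w ∈ S := by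
  classical
  obtain ⟨x, hx⟩ := hS
  obtain ⟨u, rfl⟩ := hs x
  let w : N → A → ℝ := fun i z =>
    if z ∈ S then g i z else g i (f u) + u i z - u i (f u) - 1
  refine ⟨w, fun i z hz => if_pos hz, ?_⟩
  by_contra hw
  refine hf.not_forall_lt (v := w) (u := u) (fun h => hw (h ▸ hx)) fun i => ?_
  have h1 : w i (f u) = g i (f u) := if_pos hx
  have h2 : w i (f w) = g i (f u) + u i (f w) - u i (f u) - 1 := if_neg hw
  rw [h1, h2]; linarith

theorem advantageSet_mono {α β : N → ℝ} (hα : α ∈ advantageSet f x y) (h : ∀ i, α i ≤ β i) :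
    β ∈ advantageSet f x y := by
  obtain ⟨v, hv, hlt⟩ := hα
  exact ⟨v, hv, fun i => (hlt i).trans_le (h i)⟩

theorem PositiveAssociation.neg_notMem_advantageSet (hf : PositiveAssociation f) (hxy : x ≠ y)
    {α : N → ℝ} (hα : α ∈ advantageSet f x y) : (fun i => -α i) ∉ advantageSet f y x := by
  rintro ⟨u, rfl, hu⟩
  obtain ⟨v, rfl, hv⟩ := hα
  exact hf.not_forall_lt hxy fun i => by linarith [hv i, hu i]

theorem PositiveAssociation.mem_advantageSet_of_notMem (hf : PositiveAssociation f)
    (hs : Function.Surjective f) (hxy : x ≠ y) {α β : N → ℝ} (hα : α ∉ advantageSet f x y)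
    (hβ : ∀ i, -α i < β i) : β ∈ advantageSet f y x := by
  classical
  obtain ⟨w, hw, hwS⟩ := hf.exists_mem hs (S := {x, y}) ⟨x, by simp⟩
    fun i z => if z = x then (α i - β i) / 2 else 0
  have hwx : ∀ i, w i x = (α i - β i) / 2 := fun i => by rw [hw i x (by simp)]; simp
  have hwy : ∀ i, w i y = 0 := fun i => by rw [hw i y (by simp)]; simp [hxy.symm]
  rcases hwS with h | h
  · exact absurd ⟨w, h, fun i => by rw [hwx, hwy]; linarith [hβ i]⟩ hα
  · exact ⟨w, h, fun i => by rw [hwx, hwy]; linarith [hβ i]⟩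

theorem exists_pos_sub_mem [Finite N] {U : Set (N → ℝ)} (hU : IsOpen U) {α : N → ℝ}
    (hα : α ∈ U) : ∃ ε > 0, (fun i => α i - ε) ∈ U := by
  have hc : Continuous fun ε : ℝ => fun i => α i - ε := by fun_prop
  have h0 : ∀ᶠ ε in nhds (0 : ℝ), (fun i => α i - ε) ∈ U :=
    (hU.preimage hc).mem_nhds (by simpa using hα)
  obtain ⟨ε, hε, h⟩ := Metric.eventually_nhds_iff.1 h0
  exact ⟨ε / 2, by positivity, h (by rw [Real.dist_eq, sub_zero, abs_of_pos] <;> linarith)⟩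

theorem isOpen_advantageSet [Finite N] : IsOpen (advantageSet f x y) := by
  have : advantageSet f x y =
      ⋃ v ∈ {v | f v = x}, Set.univ.pi fun i => Set.Ioi (v i x - v i y) := by
    ext α; simp [advantageSet]
  rw [this]
  exact isOpen_biUnion fun v _ => isOpen_set_pi Set.finite_univ fun i _ => isOpen_Ioi

theorem exists_const_mem_advantageSet [Finite N] (hs : Function.Surjective f) :
    ∃ r : ℝ, (fun _ => r) ∈ advantageSet f x y := by
  obtain ⟨v, rfl⟩ := hs x
  obtain ⟨M, hM⟩ := (Set.finite_range fun i => v i (f v) - v i y).bddAbove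
  exact ⟨M + 1, v, rfl, fun i => (hM ⟨i, rfl⟩).trans_lt (lt_add_one M)⟩

/-- Openness leaves room to lower `α` and `β` slightly. A profile on `{x, y, z}` with exactly these
lowered advantages cannot choose `y` or `z`, so it chooses `x`. -/
theorem PositiveAssociation.add_mem_advantageSet [Finite N] (hf : PositiveAssociation f)
    (hs : Function.Surjective f) (hxy : x ≠ y) (hyz : y ≠ z) (hxz : x ≠ z) {α β : N → ℝ}
    (hα : α ∈ advantageSet f x y) (hβ : β ∈ advantageSet f y z) :
    (fun i => α i + β i) ∈ advantageSet f x z := by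
  classical
  obtain ⟨ε, hε, v, hv, hlt⟩ := exists_pos_sub_mem isOpen_advantageSet hα
  obtain ⟨δ, hδ, u, hu, hlt'⟩ := exists_pos_sub_mem isOpen_advantageSet hβ
  obtain ⟨w, hw, hwS⟩ := hf.exists_mem hs (S := {x, y, z}) ⟨x, by simp⟩
    fun i a => if a = x then α i - ε else if a = y then 0 else -(β i - δ)
  have hwx : ∀ i, w i x = α i - ε := fun i => by rw [hw i x (by simp)]; simp
  have hwy : ∀ i, w i y = 0 := fun i => by rw [hw i y (by simp)]; simp [hxy.symm]
  have hwz : ∀ i, w i z = -(β i - δ) := fun i => by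
    rw [hw i z (by simp)]; simp [hxz.symm, hyz.symm]
  rcases hwS with h | h | h
  · exact ⟨w, h, fun i => by rw [hwx, hwz]; linarith⟩
  · refine absurd (fun i => ?_) (hf.not_forall_lt (v := v) (u := w) (by rw [hv, h]; exact hxy))
    rw [hv, h, hwx, hwy]; linarith [hlt i]
  · have h : f w = z := h
    refine absurd (fun i => ?_) (hf.not_forall_lt (v := u) (u := w) (by rw [hu, h]; exact hyz))
    rw [hu, h, hwy, hwz]; linarith [hlt' i]

/-! ### Diagonal thresholds and the common cone -/

section Gap

variable [Finite N]

theorem PositiveAssociation.const_mem_advantageSet_iff (hf : PositiveAssociation f)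
    (hs : Function.Surjective f) (hxy : x ≠ y) {r : ℝ} :
    (fun _ => r) ∈ advantageSet f x y ↔ advantageGap f x y < r := by
  -- The infimum is genuine: the diagonal part is nonempty by surjectivity, and bounded below by a
  -- diagonal point of the opposite advantage set.
  have hbdd : BddBelow {r : ℝ | (fun _ => r) ∈ advantageSet f x y} := by
    obtain ⟨s, hs'⟩ := exists_const_mem_advantageSet (x := y) (y := x) hs
    refine ⟨-s, fun r hr => ?_⟩
    by_contra! hlt
    exact hf.neg_notMem_advantageSet hxy.symm hs' (advantageSet_mono hr fun _ => hlt.le)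
  constructor
  · intro hr
    obtain ⟨ε, hε, h⟩ := exists_pos_sub_mem isOpen_advantageSet hr
    have : advantageGap f x y ≤ r - ε := csInf_le hbdd h
    linarith
  · intro hr
    obtain ⟨s, hs', hsr⟩ := exists_lt_of_csInf_lt (exists_const_mem_advantageSet hs) hr
    exact advantageSet_mono hs' fun _ => hsr.le

theorem PositiveAssociation.advantageGap_swap (hf : PositiveAssociation f)
    (hs : Function.Surjective f) (hxy : x ≠ y) :
    advantageGap f y x = -advantageGap f x y := by
  apply le_antisymm
  · refine le_of_forall_gt fun r hr => ?_
    refine (hf.const_mem_advantageSet_iff hs hxy.symm).1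
      (hf.mem_advantageSet_of_notMem hs hxy (α := fun _ => advantageGap f x y) ?_ fun _ => hr)
    rw [hf.const_mem_advantageSet_iff hs hxy]
    exact lt_irrefl _
  · by_contra! h
    obtain ⟨r, h1, h2⟩ := exists_between h
    exact hf.neg_notMem_advantageSet hxy.symm ((hf.const_mem_advantageSet_iff hs hxy.symm).2 h1)
      ((hf.const_mem_advantageSet_iff hs hxy).2 (by linarith))

theorem PositiveAssociation.advantageGap_triangle (hf : PositiveAssociation f)
    (hs : Function.Surjective f) (hxy : x ≠ y) (hyz : y ≠ z) (hxz : x ≠ z) :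
    advantageGap f x z ≤ advantageGap f x y + advantageGap f y z := by
  refine le_of_forall_gt fun r hr => (hf.const_mem_advantageSet_iff hs hxz).1 ?_
  have h := hf.add_mem_advantageSet hs hxy hyz hxz
    ((hf.const_mem_advantageSet_iff hs hxy
      (r := advantageGap f x y + (r - advantageGap f x y - advantageGap f y z) / 2)).2
      (by linarith))
    ((hf.const_mem_advantageSet_iff hs hyz
      (r := advantageGap f y z + (r - advantageGap f x y - advantageGap f y z) / 2)).2
      (by linarith))
  exact advantageSet_mono h fun _ => by linarith

theorem PositiveAssociation.advantageGap_add (hf : PositiveAssociation f)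
    (hs : Function.Surjective f) (hxy : x ≠ y) (hyz : y ≠ z) (hxz : x ≠ z) :
    advantageGap f x z = advantageGap f x y + advantageGap f y z := by
  refine le_antisymm (hf.advantageGap_triangle hs hxy hyz hxz) ?_
  have h := hf.advantageGap_triangle hs hxz hyz.symm hxy
  rw [hf.advantageGap_swap hs hyz] at h
  linarith

theorem PositiveAssociation.exists_advantageGap_eq_sub (hf : PositiveAssociation f)
    (hs : Function.Surjective f) (a : A) :
    ∃ c : A → ℝ, ∀ x y, x ≠ y → advantageGap f x y = c y - c x := by
  classical
  refine ⟨fun x => if x = a then 0 else advantageGap f a x, fun x y hxy => ?_⟩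
  by_cases hx : x = a
  · subst hx; simp [hxy.symm]
  by_cases hy : y = a
  · subst hy; simp [hx, hf.advantageGap_swap hs (Ne.symm hx)]
  · simp only [hx, hy, if_false]
    rw [hf.advantageGap_add hs hx (Ne.symm hy) hxy, hf.advantageGap_swap hs (Ne.symm hx)]
    ring

theorem PositiveAssociation.const_mem_advantageCone_iff (hf : PositiveAssociation f)
    (hs : Function.Surjective f) (hxy : x ≠ y) {r : ℝ} :
    (fun _ => r) ∈ advantageCone f x y ↔ 0 < r :=
  (hf.const_mem_advantageSet_iff hs hxy).trans (by simp)

theorem isOpen_advantageCone : IsOpen (advantageCone f x y) :=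
  isOpen_advantageSet.preimage
    (f := fun (α : N → ℝ) i => α i + advantageGap f x y) (by fun_prop)

theorem PositiveAssociation.add_mem_advantageCone (hf : PositiveAssociation f)
    (hs : Function.Surjective f) (hxy : x ≠ y) (hyz : y ≠ z) (hxz : x ≠ z) {α β : N → ℝ}
    (hα : α ∈ advantageCone f x y) (hβ : β ∈ advantageCone f y z) :
    (fun i => α i + β i) ∈ advantageCone f x z := by
  refine advantageSet_mono (hf.add_mem_advantageSet hs hxy hyz hxz hα hβ) fun i => ?_
  rw [hf.advantageGap_add hs hxy hyz hxz]
  linarith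

/-- Lower `α` by a small `ε`, then add the constant `ε`, which lies in the cone of `(y, z)`. -/
theorem PositiveAssociation.advantageCone_subset_right (hf : PositiveAssociation f)
    (hs : Function.Surjective f) (hxy : x ≠ y) (hyz : y ≠ z) (hxz : x ≠ z) :
    advantageCone f x y ⊆ advantageCone f x z := by
  intro α hα
  obtain ⟨ε, hε, h⟩ := exists_pos_sub_mem isOpen_advantageCone hα
  simpa using
    hf.add_mem_advantageCone hs hxy hyz hxz h ((hf.const_mem_advantageCone_iff hs hyz).2 hε)

theorem PositiveAssociation.advantageCone_subset_left (hf : PositiveAssociation f)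
    (hs : Function.Surjective f) (hxy : x ≠ y) (hyz : y ≠ z) (hxz : x ≠ z) :
    advantageCone f x y ⊆ advantageCone f z y := by
  intro α hα
  obtain ⟨ε, hε, h⟩ := exists_pos_sub_mem isOpen_advantageCone hα
  simpa using hf.add_mem_advantageCone hs hxz.symm hxy hyz.symm
    ((hf.const_mem_advantageCone_iff hs hxz.symm).2 hε) h

theorem PositiveAssociation.advantageCone_subset (hf : PositiveAssociation f)
    (hs : Function.Surjective f) (hA : ∀ a b : A, ∃ c, c ≠ a ∧ c ≠ b) {x' y' : A}
    (hxy : x ≠ y) (hxy' : x' ≠ y') : advantageCone f x y ⊆ advantageCone f x' y' := by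
  have right : ∀ a b c : A, a ≠ b → a ≠ c → advantageCone f a b ⊆ advantageCone f a c := by
    intro a b c hab hac
    by_cases hbc : b = c
    · rw [hbc]
    · exact hf.advantageCone_subset_right hs hab hbc hac
  have left : ∀ a b c : A, a ≠ b → c ≠ b → advantageCone f a b ⊆ advantageCone f c b := by
    intro a b c hab hcb
    by_cases hac : a = c
    · rw [hac]
    · exact hf.advantageCone_subset_left hs hab (Ne.symm hcb) hac
  by_cases h : x' = y
  -- Changing one alternative at a time would pass through the pair `(y, y)`; a third alternative
  -- `z` gives a detour.
  · subst h
    obtain ⟨z, hz, hz'⟩ := hA x x'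
    exact (right x x' z hxy hz.symm).trans
      ((left x z x' hz.symm hz'.symm).trans (right x' z y' hz'.symm hxy'))
  · exact (left x y x' hxy h).trans (right x' y y' h hxy')

end Gap

/-! ### Separation of the cone from the origin -/

/-- An open upper set of vectors that is closed under addition and contains, up to the boundary,
exactly one of each vector and its negative lies in an open half-space with nonnegative normal. -/
theorem exists_weights_of_isOpen_of_add_mem [Fintype N] {C : Set (N → ℝ)}
    (hopen : IsOpen C)
    (hup : ∀ α ∈ C, ∀ β : N → ℝ, (∀ i, α i ≤ β i) → β ∈ C)
    (hadd : ∀ α ∈ C, ∀ β ∈ C, (fun i => α i + β i) ∈ C)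
    (hzero : (0 : N → ℝ) ∉ C)
    (hneg : ∀ α ∉ C, ∀ β : N → ℝ, (∀ i, -α i < β i) → β ∈ C) :
    ∃ w ∈ stdSimplex ℝ N, ∀ α ∈ C, 0 < ∑ i, w i * α i := by
  classical
  have hpos : ∀ β : N → ℝ, (∀ i, 0 < β i) → β ∈ C := fun β hβ =>
    hneg 0 hzero β (by simpa using hβ)
  have hmul : ∀ n : ℕ, 0 < n → ∀ α ∈ C, (fun i => n * α i) ∈ C := by
    intro n hn α hα
    induction n, hn using Nat.le_induction with
    | base => simpa using hα
    | succ n hn ih =>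
      convert hadd _ ih _ hα using 2 with i
      push_cast; ring
  have hdiv : ∀ n : ℕ, 0 < n → ∀ α ∈ C, (fun i => α i / n) ∈ C := by
    intro n hn α hα
    have hn' : (0 : ℝ) < n := by exact_mod_cast hn
    -- Otherwise `-α / n + ε / n` lies in `C`; its `n`-fold sum added to `α - ε` is zero.
    by_contra h
    obtain ⟨ε, hε, hαε⟩ := exists_pos_sub_mem hopen hα
    have h1 := hmul n hn _ (hneg _ h (fun i => -(α i / n) + ε / n)
      fun i => by linarith [div_pos hε hn'])
    refine hzero ?_
    convert hadd _ hαε _ h1 using 2 with i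
    simp only [Pi.zero_apply]
    field_simp
    ring
  have hsmul : ∀ t : ℝ, 0 < t → ∀ α ∈ C, (fun i => t * α i) ∈ C := by
    intro t ht α hα
    obtain ⟨ε, hε, hαε⟩ := exists_pos_sub_mem hopen hα
    obtain ⟨M, hM⟩ := (Set.finite_range α).bddAbove
    have hM' : ∀ i, α i ≤ |M| + 1 := fun i => by
      linarith [hM ⟨i, rfl⟩, le_abs_self M]
    have hM0 : 0 < |M| + 1 := by positivity
    -- The rational `q` exceeds `t` by so little that `q * (α i - ε) ≤ t * α i`; the upper-set
    -- property then passes from `q` to `t`.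
    obtain ⟨q, hq1, hq2⟩ := exists_rat_btwn (show t < t + t * ε / (|M| + 1) by
      linarith [div_pos (mul_pos ht hε) hM0])
    have hq0 : (0 : ℝ) < q := ht.trans hq1
    have hqpos : 0 < q := by exact_mod_cast hq0
    have hnum : 0 < q.num.toNat := by
      have := Rat.num_pos.2 hqpos
      omega
    have hcast : (q : ℝ) = q.num.toNat / q.den := by
      have h1 : ((q.num.toNat : ℤ) : ℝ) = q.num := by
        rw [Int.toNat_of_nonneg (Rat.num_pos.2 hqpos).le]
      rw [Rat.cast_def, ← h1]; push_cast; rfl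
    have h := hmul _ hnum _ (hdiv _ q.den_pos _ hαε)
    refine hup _ h _ fun i => ?_
    have e : (q.num.toNat : ℝ) * ((α i - ε) / q.den) = q * (α i - ε) := by rw [hcast]; ring
    rw [e]
    have h1 : (q - t) * (|M| + 1) < t * ε := by
      rw [← lt_div_iff₀ hM0]; linarith
    have h2 : (q - t) * α i ≤ (q - t) * (|M| + 1) :=
      mul_le_mul_of_nonneg_left (hM' i) (by linarith)
    have h3 : t * ε ≤ q * ε := mul_le_mul_of_nonneg_right hq1.le hε.le
    linarith
  have hconv : Convex ℝ C := by
    refine convex_iff_forall_pos.2 fun α hα β hβ a b ha hb _ => ?_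
    exact hadd _ (hsmul a ha α hα) _ (hsmul b hb β hβ)
  obtain ⟨φ, hφ⟩ := geometric_hahn_banach_open_point hconv hopen hzero
  have hφneg : ∀ α ∈ C, φ α < 0 := fun α hα => by simpa using hφ α hα
  have hφsum : ∀ α : N → ℝ, φ α = ∑ i, φ (Pi.single i 1) * α i := by
    intro α
    conv_lhs => rw [pi_eq_sum_univ' α]
    simp [map_sum, mul_comm]
  have hone : φ 1 < 0 := hφneg 1 (hpos 1 fun _ => one_pos)
  have hbasis : ∀ i, φ (Pi.single i 1) ≤ 0 := by
    intro i
    by_contra! h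
    have hmem : (1 : N → ℝ) + (-φ 1 / φ (Pi.single i 1)) • Pi.single i (1 : ℝ) ∈ C := by
      refine hup 1 (hpos 1 fun _ => one_pos) _ fun j => ?_
      have h1 : 0 ≤ -φ 1 / φ (Pi.single i 1) := div_nonneg (by linarith) h.le
      have h2 : 0 ≤ (Pi.single i (1 : ℝ) : N → ℝ) j := by
        rw [Pi.single_apply]; split_ifs <;> norm_num
      simpa using mul_nonneg h1 h2
    have := hφneg _ hmem
    rw [map_add, map_smul, smul_eq_mul, div_mul_cancel₀ _ h.ne'] at this
    linarith
  refine ⟨fun i => φ (Pi.single i 1) / φ 1,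
    ⟨fun i => div_nonneg_of_nonpos (hbasis i) hone.le, ?_⟩, fun α hα => ?_⟩
  · have h1 := hφsum 1
    simp only [Pi.one_apply, mul_one] at h1
    rw [← Finset.sum_div, ← h1, div_self hone.ne]
  · have : ∑ i, φ (Pi.single i 1) / φ 1 * α i = φ α / φ 1 := by
      rw [hφsum α, Finset.sum_div]
      exact Finset.sum_congr rfl fun i _ => by ring
    rw [this]
    exact div_pos_of_neg_of_neg (hφneg α hα) hone

/-- Roberts' theorem: a surjective social choice function with positive association of differences
on at least three alternatives is an affine maximizer. -/
theorem PositiveAssociation.exists_affine_maximizer [Fintype N] [Fintype A]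
    (hf : PositiveAssociation f) (hs : Function.Surjective f) (hA : 3 ≤ Fintype.card A) :
    ∃ w ∈ stdSimplex ℝ N, ∃ c : A → ℝ, ∀ (v : N → A → ℝ) (a : A),
      c a + ∑ i, w i * v i a ≤ c (f v) + ∑ i, w i * v i (f v) := by
  classical
  have hthird : ∀ a b : A, ∃ c, c ≠ a ∧ c ≠ b := by
    intro a b
    have hlt : ({a, b} : Finset A).card < Fintype.card A := Finset.card_le_two.trans_lt hA
    obtain ⟨c, -, hc⟩ := Finset.exists_mem_notMem_of_card_lt_card
      (s := {a, b}) (t := Finset.univ) hlt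
    exact ⟨c, by simpa using hc⟩
  obtain ⟨x, y, hxy⟩ := Fintype.one_lt_card_iff.1 (show 1 < Fintype.card A by omega)
  obtain ⟨z, hzx, hzy⟩ := hthird x y
  have hcone : ∀ {a b a' b' : A}, a ≠ b → a' ≠ b' → ∀ {α : N → ℝ},
      α ∈ advantageCone f a b → α ∈ advantageCone f a' b' :=
    fun h h' _ hα => hf.advantageCone_subset hs hthird h h' hα
  obtain ⟨w, hw, hpos⟩ := exists_weights_of_isOpen_of_add_mem (C := advantageCone f x y)
    isOpen_advantageCone
    (fun α hα β h => advantageSet_mono hα fun i => by linarith [h i])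
    (fun α hα β hβ => hcone hzx.symm hxy <| hf.add_mem_advantageCone hs hxy hzy.symm hzx.symm hα
      (hcone hxy hzy.symm hβ))
    (fun h => lt_irrefl (0 : ℝ) ((hf.const_mem_advantageCone_iff hs hxy).1 h))
    (fun α hα β hβ => hcone hxy.symm hxy <| hf.mem_advantageSet_of_notMem hs hxy hα fun i => by
      rw [hf.advantageGap_swap hs hxy]; linarith [hβ i])
  obtain ⟨c, hc⟩ := hf.exists_advantageGap_eq_sub hs x
  refine ⟨w, hw, c, fun v a => ?_⟩
  by_cases ha : f v = a
  · rw [ha]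
  -- The slack `ε` makes the inequalities defining the advantage set strict.
  refine le_of_forall_pos_le_add fun ε hε => ?_
  have hmem : (fun i => v i (f v) - v i a + ε - advantageGap f (f v) a) ∈
      advantageCone f (f v) a := ⟨v, rfl, fun i => by linarith⟩
  have h := hpos _ (hcone ha hxy hmem)
  have e : ∑ i, w i * (v i (f v) - v i a + ε - advantageGap f (f v) a) =
      ∑ i, w i * v i (f v) - ∑ i, w i * v i a + (ε - advantageGap f (f v) a) * ∑ i, w i := by
    rw [Finset.mul_sum, ← Finset.sum_sub_distrib, ← Finset.sum_add_distrib]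
    exact Finset.sum_congr rfl fun i _ => by ring
  rw [e, hw.2, hc _ _ ha] at h
  linarith

/-! ### Truthful mechanisms on valuations -/

/-- Incentive compatibility of a direct mechanism on valuations. -/
def TruthfulOnValuations [DecidableEq N] (f : (N → A → ℝ) → A)
    (P : (N → A → ℝ) → N → ℝ) : Prop :=
  ∀ v i s, v i (f (Function.update v i s)) - P (Function.update v i s) i ≤ v i (f v) - P v i

section Truthful

variable [DecidableEq N] {P : (N → A → ℝ) → N → ℝ}

theorem TruthfulOnValuations.le_of_update (h : TruthfulOnValuations f P) (v : N → A → ℝ) (i : N)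
    (s : A → ℝ) : s (f v) - P v i ≤
      s (f (Function.update v i s)) - P (Function.update v i s) i := by
  simpa using h (Function.update v i s) i (v i)

/-- Adding the incentive constraints of `v i` and `s` against each other cancels the payments. -/
theorem TruthfulOnValuations.apply_update_eq (h : TruthfulOnValuations f P) {v : N → A → ℝ}
    {i : N} {s : A → ℝ} (hs : ∀ b, b ≠ f v → v i (f v) - v i b < s (f v) - s b) :
    f (Function.update v i s) = f v := by
  by_contra hne
  have h1 := h v i s
  have h2 := h.le_of_update v i s
  linarith [hs _ hne]

theorem TruthfulOnValuations.positiveAssociation [Fintype N] (h : TruthfulOnValuations f P) :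
    PositiveAssociation f := by
  intro v v' hv
  suffices H : ∀ S : Finset N, f (S.piecewise v' v) = f v by simpa using H Finset.univ
  intro S
  induction S using Finset.induction_on with
  | empty => simp
  | insert i S hi ih =>
    rw [Finset.piecewise_insert, h.apply_update_eq, ih]
    intro b hb
    rw [ih] at hb ⊢
    rw [Finset.piecewise_eq_of_notMem _ _ _ hi]
    exact hv i b hb

variable [Fintype N]

theorem TruthfulOnValuations.payment_le (h : TruthfulOnValuations f P) {w : N → ℝ} {c : A → ℝ}
    (hmax : ∀ v a, c a + ∑ i, w i * v i a ≤ c (f v) + ∑ i, w i * v i (f v)) {i : N}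
    (hi : 0 < w i) (v : N → A → ℝ) (s : A → ℝ) :
    P v i + 1 / w i * (c (f v) + ∑ j ∈ univ.erase i, w j * v j (f v)) ≤
      P (Function.update v i s) i + 1 / w i * (c (f (Function.update v i s)) +
        ∑ j ∈ univ.erase i, w j * v j (f (Function.update v i s))) := by
  classical
  set φ : A → ℝ := fun a => 1 / w i * (c a + ∑ j ∈ univ.erase i, w j * v j a) with hφ
  change P v i + φ (f v) ≤ P (Function.update v i s) i + φ (f (Function.update v i s))
  refine le_of_forall_pos_le_add fun ε hε => ?_
  -- Under `r`, agent `i` offsets the rest of the objective and leaves a bonus `ε` at `f v`, which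
  -- is therefore chosen. Incentive constraints at `r` bound the payments up to `ε`.
  let r : A → ℝ := fun a => -φ a + if a = f v then ε else 0
  have hr : ∀ a, r a = -φ a + if a = f v then ε else 0 := fun a => rfl
  have hsum : ∀ a, c a + ∑ j, w j * (Function.update v i r) j a = w i * (r a + φ a) := by
    intro a
    rw [← Finset.add_sum_erase _ _ (Finset.mem_univ i), Function.update_self]
    have : ∑ j ∈ univ.erase i, w j * Function.update v i r j a =
        ∑ j ∈ univ.erase i, w j * v j a := Finset.sum_congr rfl fun j hj => by
      rw [Function.update_of_ne (Finset.ne_of_mem_erase hj)]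
    rw [this, hφ]
    field_simp
    ring
  have hfr : f (Function.update v i r) = f v := by
    by_contra hne
    have h1 := hmax (Function.update v i r) (f v)
    rw [hsum, hsum] at h1
    have h2 := le_of_mul_le_mul_left h1 hi
    rw [hr, hr, if_pos rfl, if_neg hne] at h2
    linarith
  have h2 := h (Function.update v i r) i s
  have h3 := h v i r
  rw [hfr] at h2 h3
  rw [Function.update_idem, Function.update_self] at h2
  have h4 : -φ (f (Function.update v i s)) ≤ r (f (Function.update v i s)) := by
    rw [hr]; split_ifs <;> linarith
  have h5 : r (f v) = -φ (f v) + ε := by rw [hr, if_pos rfl]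
  linarith

theorem TruthfulOnValuations.payment_eq (h : TruthfulOnValuations f P) {w : N → ℝ} {c : A → ℝ}
    (hmax : ∀ v a, c a + ∑ i, w i * v i a ≤ c (f v) + ∑ i, w i * v i (f v)) {i : N}
    (hi : 0 < w i) {v v' : N → A → ℝ} (hv : ∀ j, j ≠ i → v j = v' j) :
    P v i + 1 / w i * (c (f v) + ∑ j ∈ univ.erase i, w j * v j (f v)) =
      P v' i + 1 / w i * (c (f v') + ∑ j ∈ univ.erase i, w j * v' j (f v')) := by
  have hu : ∀ {v v' : N → A → ℝ}, (∀ j, j ≠ i → v j = v' j) →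
      Function.update v i (v' i) = v' := fun {v v'} hv => by
    ext1 j
    by_cases hj : j = i
    · subst hj; simp
    · simp [hj, hv j hj]
  have hsum : ∀ a, ∑ j ∈ univ.erase i, w j * v j a = ∑ j ∈ univ.erase i, w j * v' j a :=
    fun a => Finset.sum_congr rfl fun j hj => by rw [hv j (Finset.ne_of_mem_erase hj)]
  have h1 := h.payment_le hmax hi v (v' i)
  have h2 := h.payment_le hmax hi v' (v i)
  rw [hu hv, hsum, hsum] at h1
  rw [hu fun j hj => (hv j hj).symm] at h2
  rw [hsum]
  exact le_antisymm h1 h2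

end Truthful

end AffineMaximizers

/-! ### From valuations to preferences -/

section Preferences

variable {N A : Type*} {D : N → Set (Preference A)}

theorem Represents.unique {u : A × ℝ → ℝ} {t t' : Preference A} (h : Represents u t)
    (h' : Represents u t') : t = t' := by
  have : t.rel = t'.rel := by
    funext ⟨a, za⟩ ⟨b, zb⟩
    exact propext ((h a b za zb).trans (h' a b za zb).symm)
  cases t; cases t'; cases this; rfl

theorem IsQuasiLinearChoice.apply_eq {u : ∀ i, D i → A × ℝ → ℝ} (hu : IsQuasiLinearChoice D u)
    (i : N) (s : D i) (a : A) (z : ℝ) : u i s (a, z) = u i s (a, 0) - z := by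
  obtain ⟨v, hv⟩ := (hu i s).1
  rw [hv, hv]; ring

theorem IsQuasiLinearChoice.rel_iff {u : ∀ i, D i → A × ℝ → ℝ} (hu : IsQuasiLinearChoice D u)
    (i : N) (s : D i) (a b : A) (z z' : ℝ) :
    (s : Preference A).rel (a, z) (b, z') ↔ u i s (b, 0) - z' ≤ u i s (a, 0) - z := by
  rw [(hu i s).2, hu.apply_eq, hu.apply_eq i s b]

theorem others_update [DecidableEq N] (t : Profile D) (i : N) (s : D i) :
    others (Function.update t i s) i = others t i := by
  funext j
  exact Function.update_of_ne j.2 _ _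

theorem eq_update_of_others_eq [DecidableEq N] {t t' : Profile D} {i : N}
    (h : others t i = others t' i) : t' = Function.update t i (t' i) := by
  funext j
  by_cases hj : j = i
  · subst hj; simp
  · rw [Function.update_of_ne hj]; exact (congrFun h ⟨j, hj⟩).symm

/-- If two reports led to the same alternative at different prices, the type paying more would
imitate the other. -/
theorem IsIncentiveCompatible.payment_eq [DecidableEq N] {x : Profile D → A}
    {p : Profile D → N → ℝ} {u : ∀ i, D i → A × ℝ → ℝ} (hu : IsQuasiLinearChoice D u)
    (h : IsIncentiveCompatible x p) {t t' : Profile D} {i : N}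
    (ho : others t i = others t' i) (hx : x t = x t') : p t i = p t' i := by
  have key : ∀ {t t' : Profile D}, others t i = others t' i → x t = x t' → p t i ≤ p t' i := by
    intro t t' ho hx
    have h1 := h t i (t' i)
    rw [← eq_update_of_others_eq ho, hu.rel_iff, hx] at h1
    linarith
  exact le_antisymm (key ho hx) (key ho.symm hx.symm)

variable [Fintype N] [DecidableEq N]

theorem IsPreferenceVCG.isIncentiveCompatible {A' : Set A} {w : N → ℝ} {c : A → ℝ}
    (hw : w ∈ stdSimplex ℝ N) {u : ∀ i, D i → A × ℝ → ℝ} (hu : IsQuasiLinearChoice D u)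
    {x : Profile D → A} {p : Profile D → N → ℝ} (h : IsPreferenceVCG A' w c u x p) :
    IsIncentiveCompatible x p := by
  intro t i s
  rcases (hw.1 i).eq_or_lt with hi | hi
  · obtain ⟨g, hg⟩ := h.payment_of_zero i hi.symm
    rw [h.noInfluence i hi.symm t s, hg, hg, others_update]
    exact ((t i : Preference A).total _ _).elim id id
  · obtain ⟨g, hg⟩ := h.payment_of_pos i hi
    rw [hu.rel_iff, hg, hg, others_update]
    have hsum : ∀ a, ∑ j ∈ univ.erase i, w j * u j (Function.update t i s j) (a, 0) =
        ∑ j ∈ univ.erase i, w j * u j (t j) (a, 0) := fun a =>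
      Finset.sum_congr rfl fun j hj => by rw [Function.update_of_ne (Finset.ne_of_mem_erase hj)]
    have hmax := (h.maximizes t).2 _ (h.maximizes (Function.update t i s)).1
    rw [← Finset.add_sum_erase _ _ (Finset.mem_univ i),
      ← Finset.add_sum_erase _ _ (Finset.mem_univ i)] at hmax
    rw [hsum]
    have e : ∀ m y S : ℝ, y - (g (others t i) - 1 / w i * (m + S)) =
        1 / w i * (m + (w i * y + S)) - g (others t i) := fun m y S => by
      field_simp; ring
    rw [e, e]
    have := mul_le_mul_of_nonneg_left hmax (one_div_pos.2 hi).le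
    linarith

/-- Transfer of Roberts' theorem from valuations to preferences. -/
theorem IsIncentiveCompatible.exists_affine_maximizer [Fintype A] (hA : 3 ≤ Fintype.card A)
    (hD : ∀ i, ∀ t ∈ D i, ∃ u : A × ℝ → ℝ, IsQuasiLinear u ∧ Represents u t)
    (hrich : ∀ (i : N) (u : A × ℝ → ℝ), IsQuasiLinear u → ∃ t ∈ D i, Represents u t)
    {x : Profile D → A} {p : Profile D → N → ℝ} (hx : Function.Surjective x)
    (hic : IsIncentiveCompatible x p) :
    ∃ w ∈ stdSimplex ℝ N, ∃ c : A → ℝ, ∀ u : ∀ i, D i → A × ℝ → ℝ, IsQuasiLinearChoice D u →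
      IsAffineMaximizer Set.univ w c u x ∧ ∀ i, 0 < w i → HasVCGPayment w c u x p i := by
  have hτ : ∀ (i : N) (v : A → ℝ), ∃ s : D i,
      Represents (fun o : A × ℝ => v o.1 - o.2) (s : Preference A) := fun i v => by
    obtain ⟨t, ht, h⟩ := hrich i (fun o => v o.1 - o.2) ⟨v, fun _ _ => rfl⟩
    exact ⟨⟨t, ht⟩, h⟩
  choose τ hτ using hτ
  let T : (N → A → ℝ) → Profile D := fun v i => τ i (v i)
  -- A utility represents at most one preference, so any choice `u` is undone by `T`. Hence `w` and
  -- `c` serve all choices at once.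
  have hT : ∀ {u : ∀ i, D i → A × ℝ → ℝ}, IsQuasiLinearChoice D u → ∀ t : Profile D,
      T (fun i a => u i (t i) (a, 0)) = t := by
    intro u hu t
    funext i
    refine Subtype.ext ((hτ i _).unique ?_)
    convert (hu i (t i)).2 using 1
    funext ⟨a, z⟩
    exact (hu.apply_eq i (t i) a z).symm
  have hupd : ∀ v i s, T (Function.update v i s) = Function.update (T v) i (τ i s) := by
    intro v i s
    funext j
    by_cases hj : j = i
    · subst hj; simp [T]
    · simp [T, hj]
  have htruth : TruthfulOnValuations (fun v => x (T v)) (fun v => p (T v)) := by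
    intro v i s
    have h := (hτ i (v i) _ _ _ _).1 (hic (T v) i (τ i s))
    simpa only [hupd] using h
  have hsurj : Function.Surjective fun v => x (T v) := by
    choose u₀ hu₀ using hD
    have hu : IsQuasiLinearChoice D fun i s => u₀ i s s.2 := fun i s => hu₀ i s s.2
    intro a
    obtain ⟨t, rfl⟩ := hx a
    exact ⟨_, congrArg x (hT hu t)⟩
  obtain ⟨w, hw, c, hmax⟩ := htruth.positiveAssociation.exists_affine_maximizer hsurj hA
  refine ⟨w, hw, c, fun u hu => ⟨fun t => ⟨Set.mem_univ _, fun a _ => ?_⟩, fun i hi => ?_⟩⟩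
  · simpa only [hT hu] using hmax (fun i a => u i (t i) (a, 0)) a
  · have hfactor : Function.FactorsThrough (fun t : Profile D => p t i +
        1 / w i * (c (x t) + ∑ j ∈ univ.erase i, w j * u j (t j) (x t, 0)))
        (fun t => others t i) := by
      intro t t' ho
      have h := htruth.payment_eq hmax hi (v := fun i a => u i (t i) (a, 0))
        (v' := fun i a => u i (t' i) (a, 0)) fun j hj => by
          rw [show t j = t' j from congrFun ho ⟨j, hj⟩]
      simpa only [hT hu] using h
    obtain ⟨g, hg⟩ := (Function.factorsThrough_iff _).1 hfactor
    refine ⟨g, fun t => ?_⟩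
    have := congrFun hg t
    simp only [Function.comp_apply] at this
    linarith

end Preferences

theorem mainTheorem4 {N A : Type*} [Fintype N] [DecidableEq N] [Fintype A]
    (D : N → Set (Preference A))
    (hD : ∀ i, ∀ t ∈ D i, ∃ u : A × ℝ → ℝ, IsQuasiLinear u ∧ Represents u t) :
    (∀ (A' : Set A) (w : N → ℝ) (c : A → ℝ), A'.Nonempty → w ∈ stdSimplex ℝ N →
      ∀ u : ∀ i, D i → A × ℝ → ℝ, IsQuasiLinearChoice D u →
        ∀ (x : Profile D → A) (p : Profile D → N → ℝ),
          IsPreferenceVCG A' w c u x p → IsIncentiveCompatible x p) ∧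
    (3 ≤ Fintype.card A →
      (∀ (i : N) (u : A × ℝ → ℝ), IsQuasiLinear u → ∃ t ∈ D i, Represents u t) →
      ∀ (x : Profile D → A) (p : Profile D → N → ℝ),
        Function.Surjective x → IsIncentiveCompatible x p →
        ∃ w ∈ stdSimplex ℝ N, ∃ c : A → ℝ,
          ∀ u : ∀ i, D i → A × ℝ → ℝ, IsQuasiLinearChoice D u →
            IsAffineMaximizer Set.univ w c u x ∧
            (∀ i, 0 < w i → HasVCGPayment w c u x p i) ∧
            (∀ i, w i = 0 → ∃ h : OthersProfile D i → A → ℝ,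
              ∀ t : Profile D, p t i = h (others t i) (x t)) ∧
            ((∀ i, w i = 0 → HasNoInfluence x i) →
              IsPreferenceVCG Set.univ w c u x p)) := by
  refine ⟨fun A' w c _ hw u hu x p h => h.isIncentiveCompatible hw hu,
    fun hA hrich x p hx hic => ?_⟩
  obtain ⟨w, hw, c, h⟩ := hic.exists_affine_maximizer hA hD hrich hx
  refine ⟨w, hw, c, fun u hu => ⟨(h u hu).1, (h u hu).2, fun i _ => ?_, fun hinf =>
    ⟨(h u hu).1, hinf, (h u hu).2, fun i hi => ?_⟩⟩⟩
  · have hfactor : Function.FactorsThrough (fun t : Profile D => p t i)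
        (fun t => (others t i, x t)) := fun t t' ho =>
      hic.payment_eq hu (Prod.ext_iff.1 ho).1 (Prod.ext_iff.1 ho).2
    obtain ⟨g, hg⟩ := (Function.factorsThrough_iff _).1 hfactor
    exact ⟨fun o a => g (o, a), fun t => congrFun hg t⟩
  · have hfactor : Function.FactorsThrough (fun t : Profile D => p t i)
        (fun t => others t i) := fun t t' ho => by
      refine hic.payment_eq hu ho ?_
      rw [eq_update_of_others_eq ho]
      exact (hinf i hi t _).symm
    obtain ⟨g, hg⟩ := (Function.factorsThrough_iff _).1 hfactor
    exact ⟨g, fun t => congrFun hg t⟩
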